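/- Let $N\ge 2$ and let $(K,V_i)_{i=0}^{N-1}$ be a row co-isometry: $K$ is a complex Hilbert space and $V_0,\dots,V_{N-1}$ are bounded operators on $K$ with $\sum_{i=0}^{N-1}V_iV_i^*=1_K$. Let $(H,S_i)_{i=0}^{N-1}$ be its Cuntz dilation: $H$ is a Hilbert space containing $K$ as a closed subspace, the bounded operators $S_i$ on $H$ satisfy the Cuntz relations $S_i^*S_j=\delta_{ij}1_H$ and $\sum_{i=0}^{N-1}S_iS_i^*=1_H$, one has $S_i^*K\subseteq K$ and $S_i^*|_K=V_i^*$ for all $i$ (so $V_i=pS_i|_K$, where $p$ is the orthogonal projection of $H$ onto $K$), and $K$ is cyclic for the $*$-algebra generated by the $S_i$, i.e. the vectors $Ak$ with $A$ in this algebra and $k\in K$ have dense linear span in $H$. Let $\Omega$ be the set of finite words over $\{0,\dots,N-1\}$, including the empty word, and for $\omega=\omega_1\cdots\omega_n\in\Omega$ put $V_\omega=V_{\omega_1}\cdots V_{\omega_n}$ and $S_\omega=S_{\omega_1}\cdots S_{\omega_n}$, with the empty word giving the identity. Let $\beta=i_0\cdots i_{p-1}\in\Omega$ be a non-empty word that is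 irreducible, i.e. not of the form $\omega\omega\cdots\omega$ ($k$ times) for a word $\omega$ and an integer $k\ge2$, and let $\Omega_\beta$ be the set of all words in $\Omega$ that do not end in $\beta$ (it contains the empty word). Let $v_0\in K$ be a unit vector with $V_{i_{p-1}}^*\cdots V_{i_0}^*v_0=v_0$, i.e. $V_\beta^*v_0=v_0$. Then the following are equivalent: 1. The family $(V_\omega v_0)_{\omega\in\Omega_\beta}$ is a Parseval frame for $K$, i.e. $\|v\|^2=\sum_{\omega\in\Omega_\beta}|\langle v,V_\omega v_0\rangle|^2$ for all $v\in K$. 2. The family $(S_\omega v_0)_{\omega\in\Omega_\beta}$ is an orthonormal basis of $H$. 3. The closed linear span of $\{S_\omega v_0:\omega\in\Omega\}$ is $H$. 4. The representation $(H,S_i)_{i=0}^{N-1}$ is irreducible, i.e. $H\ne0$ and the only closed subspaces of $H$ invariant under all $S_i$ and $S_i^*$ are $\{0\}$ and $H$. 5. The commutant $\{S_0,\dots,S_{N-1}\}'$ in $\mathcal B(H)$ equals $\mathbb C\cdot 1_H$. 6. $\mathcal B(K)^\sigma:=\{A\in\mathcal B(K):\sum_{i=0}^{N-1}V_iAV_i^*=A\}$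 equals $\mathbb C\cdot 1_K$. -/

import Mathlib

open ContinuousLinearMap

noncomputable section

/-- Words `ω = ω₁ … ωₙ` are lists of digits; the operator `T_ω = T_{ω₁} ⋯ T_{ωₙ}`
(composition), the identity for the empty word. -/
def wordOp {N : ℕ} {E : Type*} [NormedAddCommGroup E] [InnerProductSpace ℂ E]
    (T : Fin N → E →L[ℂ] E) (ω : List (Fin N)) : E →L[ℂ] E :=
  (ω.map T).prod

/-- A non-empty word which is not of the form `ω ω ⋯ ω` (`k ≥ 2` times). -/
def IsIrreducibleWord {α : Type*} (β : List α) : Prop :=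
  β ≠ [] ∧ ¬ ∃ (ω : List α) (k : ℕ), 2 ≤ k ∧ β = (List.replicate k ω).flatten

/-- The set `Ω_β` of the words that do not end in `β`. -/
def wordsNotEndingIn {α : Type*} (β : List α) : Set (List α) :=
  {ω | ¬ β <:+ ω}

/-- Row co-isometry: `∑ V_i V_i^* = 1`. -/
def IsRowCoisometry {N : ℕ} {K : Type*} [NormedAddCommGroup K] [InnerProductSpace ℂ K]
    [CompleteSpace K] (V : Fin N → K →L[ℂ] K) : Prop :=
  ∑ i, V i * adjoint (V i) = 1

/-- Cuntz relations, i.e. a representation of the Cuntz algebra `𝒪_N`: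
`S_i^* S_j = δ_{ij}` and `∑ S_i S_i^* = 1`. -/
structure IsCuntzFamily {N : ℕ} {H : Type*} [NormedAddCommGroup H] [InnerProductSpace ℂ H]
    [CompleteSpace H] (S : Fin N → H →L[ℂ] H) : Prop where
  adjoint_mul : ∀ i j, adjoint (S i) * S j = if i = j then 1 else 0
  sum_mul_adjoint : ∑ i, S i * adjoint (S i) = 1

/-- `(H, S)` is the Cuntz dilation of `(K, V)`, where `K` is embedded in `H` by `ι`:
`S` satisfies the Cuntz relations, each `S_i^*` leaves (the image of) `K` invariant and restricts
to `V_i^*` there (equivalently `V_i^* p = S_i^* p = p S_i^* p`, which gives `V_i = p S_i|_K`), and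
`K` is cyclic for the *-algebra generated by the `S_i`. -/
structure IsCuntzDilation {N : ℕ} {K H : Type*}
    [NormedAddCommGroup K] [InnerProductSpace ℂ K] [CompleteSpace K]
    [NormedAddCommGroup H] [InnerProductSpace ℂ H] [CompleteSpace H]
    (V : Fin N → K →L[ℂ] K) (S : Fin N → H →L[ℂ] H) (ι : K →ₗᵢ[ℂ] H) : Prop where
  cuntz : IsCuntzFamily S
  adjoint_apply : ∀ i k, adjoint (S i) (ι k) = ι (adjoint (V i) k)
  cyclic : (Submodule.span ℂ
    {x : H | ∃ A ∈ StarAlgebra.adjoin ℂ (Set.range S), ∃ k : K, x = A (ι k)}).topologicalClosure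
      = ⊤

/-- Parseval frame: `‖v‖² = ∑ |⟨v, e_j⟩|²` for all `v`. -/
def IsParsevalFrame {J E : Type*} [NormedAddCommGroup E] [InnerProductSpace ℂ E]
    (e : J → E) : Prop :=
  ∀ v : E, HasSum (fun j => ‖inner ℂ v (e j)‖ ^ 2) (‖v‖ ^ 2)

/-- The family is an orthonormal basis, in the Hilbert space sense. -/
def IsONB {J E : Type*} [NormedAddCommGroup E] [InnerProductSpace ℂ E] (e : J → E) : Prop :=
  ∃ b : HilbertBasis J ℂ E, ⇑b = e

/-- Irreducibility of the representation given by `S`: the space is non-zero and the only closed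
subspaces invariant under all `S_i` and `S_i^*` are `0` and the whole space. -/
def IsIrreducibleRep {N : ℕ} {H : Type*} [NormedAddCommGroup H] [InnerProductSpace ℂ H]
    [CompleteSpace H] (S : Fin N → H →L[ℂ] H) : Prop :=
  Nontrivial H ∧ ∀ W : Submodule ℂ H, IsClosed (W : Set H) →
    (∀ i, ∀ x ∈ W, S i x ∈ W) → (∀ i, ∀ x ∈ W, adjoint (S i) x ∈ W) → W = ⊥ ∨ W = ⊤

/-- The scalar operators `ℂ · 1`. -/
def scalarOps (E : Type*) [NormedAddCommGroup E] [InnerProductSpace ℂ E] : Set (E →L[ℂ] E) :=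
  Set.range fun c : ℂ => c • (1 : E →L[ℂ] E)

/-- The fixed points of `σ(A) = ∑ V_i A V_i^*`. -/
def sigmaFixedPoints {N : ℕ} {K : Type*} [NormedAddCommGroup K] [InnerProductSpace ℂ K]
    [CompleteSpace K] (V : Fin N → K →L[ℂ] K) : Set (K →L[ℂ] K) :=
  {A | ∑ i, V i * A * adjoint (V i) = A}

end

/-!
Appending powers of `β` to two distinct words of `Ω_β` makes them incomparable for the prefix order,
because a word commuting with the irreducible word `β` is a power of `β`. Since `S_β v₀ = v₀`, this
makes `(S_ω v₀)_{ω ∈ Ω_β}` orthonormal, and its closed span is a reducing subspace. So (1), (2) and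
(4) each amount to cyclicity (3): for (1), the equality case of Bessel's inequality puts `K` in this
span, and `K` generates `H`.

For (3) ⇒ (6), put `σ_T(X) = ∑ T_i X T_i^*`. Compression to `K` intertwines `σ_S` with `σ_V`, so a
fixed point `B` of `σ_V` is the compression of every `σ_S^n(B p)`. If `⟨B v₀, v₀⟩ = 0`, the relation
`σ_S(X) S_i = S_i X` makes the matrix coefficients of these operators at `S_γ v₀`, `S_δ v₀` vanish
for large `n`; they are bounded uniformly in `n`, so they tend weakly to `0` and `B = 0`. In
general, apply this to `B - ⟨v₀, B v₀⟩`. For (6) ⇒ (5), the commutant is the fixed-point space of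
`σ_S`, on which compression to `K` is injective.
-/

open Filter Topology

section Words

variable {α : Type*}

/-- The `k`-th power `w w ⋯ w` of a word, in the form used by `IsIrreducibleWord`. -/
def wordPow (w : List α) (k : ℕ) : List α :=
  (List.replicate k w).flatten

@[simp] theorem wordPow_zero (w : List α) : wordPow w 0 = [] := rfl

@[simp] theorem wordPow_one (w : List α) : wordPow w 1 = w := by
  simp [wordPow]

theorem wordPow_add (w : List α) (a b : ℕ) : wordPow w (a + b) = wordPow w a ++ wordPow w b := by
  simp only [wordPow, List.replicate_add, List.flatten_append]

@[simp] theorem length_wordPow (w : List α) (k : ℕ) : (wordPow w k).length = k * w.length := by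
  simp [wordPow]

theorem exists_eq_wordPow_of_append_comm {x y : List α} (h : x ++ y = y ++ x) :
    ∃ w a b, x = wordPow w a ∧ y = wordPow w b := by
  induction hn : x.length + y.length using Nat.strong_induction_on generalizing x y with
  | _ n ih =>
  wlog hle : x.length ≤ y.length generalizing x y
  · obtain ⟨w, a, b, hx, hy⟩ := this h.symm (by lia) (by lia)
    exact ⟨w, b, a, hy, hx⟩
  rcases eq_or_ne x [] with rfl | hx
  · exact ⟨y, 0, 1, by simp, by simp⟩
  obtain ⟨z, rfl⟩ : x <+: y := List.prefix_of_prefix_length_le ⟨y, h⟩ (List.prefix_append y x) hle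
  have hz : x ++ z = z ++ x := by simpa using h
  have hx_pos : 0 < x.length := List.length_pos_iff.mpr hx
  obtain ⟨w, a, b, ha, hb⟩ := ih (x.length + z.length)
    (by simp only [List.length_append] at hn; lia) hz rfl
  exact ⟨w, a, a + b, ha, by rw [wordPow_add, ← ha, ← hb]⟩

theorem append_comm_of_append_prefix_wordPow {ε β : List α} {k : ℕ}
    (h : ε ++ β <+: wordPow β k) : ε ++ β = β ++ ε := by
  have h₁ : ε ++ β <+: wordPow β (k + 1) := by
    rw [wordPow_add]
    exact h.trans (List.prefix_append _ _)
  have h₂ : β ++ ε <+: wordPow β (k + 1) := by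
    rw [add_comm, wordPow_add, wordPow_one, List.prefix_append_right_inj]
    exact (List.prefix_append ε β).trans h
  have hlen : (ε ++ β).length = (β ++ ε).length := by simp [add_comm]
  exact (List.prefix_of_prefix_length_le h₁ h₂ hlen.le).eq_of_length hlen

theorem exists_eq_append_wordPow {β : List α} (hβ : β ≠ []) (ω : List α) :
    ∃ τ ∈ wordsNotEndingIn β, ∃ k, ω = τ ++ wordPow β k := by
  induction hn : ω.length using Nat.strong_induction_on generalizing ω with
  | _ n ih =>
  by_cases hω : β <:+ ω
  · obtain ⟨ω', rfl⟩ := hω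
    have hβ_pos : 0 < β.length := List.length_pos_iff.mpr hβ
    obtain ⟨τ, hτ, k, rfl⟩ := ih ω'.length (by simp only [List.length_append] at hn; lia) ω' rfl
    exact ⟨τ, hτ, k + 1, by rw [wordPow_add, wordPow_one, List.append_assoc]⟩
  · exact ⟨ω, hω, 0, by simp⟩

namespace IsIrreducibleWord

variable {β : List α}

theorem exists_eq_wordPow_of_append_comm (hβ : IsIrreducibleWord β) {ε : List α}
    (h : ε ++ β = β ++ ε) : ∃ j, ε = wordPow β j := by
  obtain ⟨w, a, b, rfl, rfl⟩ := _root_.exists_eq_wordPow_of_append_comm h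
  have hb₀ : b ≠ 0 := by
    rintro rfl
    exact hβ.1 (wordPow_zero w)
  have hb₂ : ¬ 2 ≤ b := fun hb => hβ.2 ⟨w, b, hb, rfl⟩
  obtain rfl : b = 1 := by lia
  exact ⟨a, by rw [wordPow_one]⟩

theorem not_append_prefix_append_wordPow (hβ : IsIrreducibleWord β) {γ δ : List α}
    (hδ : δ ∈ wordsNotEndingIn β) (hne : γ ≠ δ) (hle : γ.length ≤ δ.length) (k : ℕ) :
    ¬ δ ++ β <+: γ ++ wordPow β k := by
  intro h
  obtain ⟨ε, rfl⟩ : γ <+: δ := List.prefix_of_prefix_length_le (List.prefix_append _ _)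
    ((List.prefix_append _ _).trans h) hle
  rw [List.append_assoc, List.prefix_append_right_inj] at h
  obtain ⟨j, rfl⟩ :=
    hβ.exists_eq_wordPow_of_append_comm (append_comm_of_append_prefix_wordPow h)
  cases j with
  | zero => exact hne (by simp)
  | succ j => exact hδ ⟨γ ++ wordPow β j, by rw [wordPow_add, wordPow_one, List.append_assoc]⟩

theorem exists_incomparable (hβ : IsIrreducibleWord β) {γ δ : List α}
    (hγ : γ ∈ wordsNotEndingIn β) (hδ : δ ∈ wordsNotEndingIn β) (hne : γ ≠ δ) :
    ∃ k m, ¬ γ ++ wordPow β k <+: δ ++ wordPow β m ∧ ¬ δ ++ wordPow β m <+: γ ++ wordPow β k := by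
  wlog hle : γ.length ≤ δ.length generalizing γ δ
  · obtain ⟨k, m, h⟩ := this hδ hγ hne.symm (by lia)
    exact ⟨m, k, h.symm⟩
  -- The power of `β` after `γ` is taken so large that only the second relation could hold.
  have hnot : ¬ δ ++ wordPow β 1 <+: γ ++ wordPow β (δ.length + 1) := by
    rw [wordPow_one]
    exact hβ.not_append_prefix_append_wordPow hδ hne hle _
  refine ⟨δ.length + 1, 1, fun h => hnot ?_, hnot⟩
  have hβ_pos : 0 < β.length := List.length_pos_iff.mpr hβ.1
  have hlen : (δ ++ wordPow β 1).length ≤ (γ ++ wordPow β (δ.length + 1)).length := by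
    simp only [List.length_append, length_wordPow, add_mul]
    have := Nat.le_mul_of_pos_right δ.length hβ_pos
    lia
  rw [h.eq_of_length_le hlen]

end IsIrreducibleWord

end Words

section Hilbert

theorem tendsto_zero_of_dense_span {ι 𝕜 𝕜' E F : Type*} [NontriviallyNormedField 𝕜]
    [NontriviallyNormedField 𝕜'] {φ : 𝕜 →+* 𝕜'} [RingHomIsometric φ]
    [SeminormedAddCommGroup E] [NormedSpace 𝕜 E] [SeminormedAddCommGroup F] [NormedSpace 𝕜' F]
    {s : Set E} (hs : Dense (Submodule.span 𝕜 s : Set E)) {l : Filter ι} {f : ι → E →SL[φ] F}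
    {C : ℝ} (hC : ∀ n x, ‖f n x‖ ≤ C * ‖x‖) (h : ∀ x ∈ s, Tendsto (fun n => f n x) l (𝓝 0))
    (x : E) : Tendsto (fun n => f n x) l (𝓝 0) := by
  have hclosed : IsClosed {x | Tendsto (fun n => f n x) l (𝓝 0)} :=
    (LipschitzWith.uniformEquicontinuous _ C.toNNReal fun n =>
      AddMonoidHomClass.lipschitz_of_bound (f n) C (hC n)).equicontinuous.isClosed_setOfPred_tendsto
      continuous_const
  refine closure_minimal (fun y hy => ?_) hclosed (hs x)
  induction hy using Submodule.span_induction with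
  | mem y hy => exact h y hy
  | zero => simpa using tendsto_const_nhds
  | add y z _ _ hy hz => simpa using hy.add hz
  | smul c y _ hy => simpa using hy.const_smul (φ c)

theorem tendsto_inner_zero_of_dense_span {ι 𝕜 E : Type*} [RCLike 𝕜] [SeminormedAddCommGroup E]
    [InnerProductSpace 𝕜 E] {s : Set E} (hs : Dense (Submodule.span 𝕜 s : Set E)) {l : Filter ι}
    {T : ι → E →L[𝕜] E} {C : ℝ} (hC : ∀ n, ‖T n‖ ≤ C)
    (h : ∀ x ∈ s, ∀ y ∈ s, Tendsto (fun n => inner 𝕜 (T n x) y) l (𝓝 0)) (x y : E) :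
    Tendsto (fun n => inner 𝕜 (T n x) y) l (𝓝 0) := by
  have hbound (n : ι) (x y : E) : ‖inner 𝕜 (T n x) y‖ ≤ C * ‖x‖ * ‖y‖ :=
    (norm_inner_le_norm _ _).trans (by gcongr; exact (T n).le_of_opNorm_le (hC n) x)
  have hright (x : E) (hx : x ∈ s) (y : E) : Tendsto (fun n => inner 𝕜 (T n x) y) l (𝓝 0) :=
    tendsto_zero_of_dense_span (f := fun n => innerSL 𝕜 (T n x)) hs (hbound · x) (h x hx) y
  refine tendsto_zero_of_dense_span (f := fun n => (innerSLFlip 𝕜 y).comp (T n)) (C := C * ‖y‖) hs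
    (fun n x => ?_) (fun x hx => hright x hx y) x
  exact (hbound n x y).trans_eq (by ring)

variable {E : Type*} [NormedAddCommGroup E] [InnerProductSpace ℂ E]

theorem mem_topologicalClosure_span_of_hasSum_sq_norm_inner {J : Type*} [CompleteSpace E]
    {e : J → E} (he : Orthonormal ℂ e) {x : E}
    (hx : HasSum (fun j => ‖inner ℂ x (e j)‖ ^ 2) (‖x‖ ^ 2)) :
    x ∈ (Submodule.span ℂ (Set.range e)).topologicalClosure := by
  set W := (Submodule.span ℂ (Set.range e)).topologicalClosure
  have hmem (j : J) : e j ∈ W :=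
    Submodule.le_topologicalClosure _ (Submodule.subset_span ⟨j, rfl⟩)
  have hinner (j : J) : inner ℂ (e j) (W.starProjection x) = inner ℂ (e j) x := by
    rw [← Submodule.inner_starProjection_left_eq_right,
      Submodule.starProjection_eq_self_iff.mpr (hmem j)]
  have hbessel : ‖x‖ ^ 2 ≤ ‖W.starProjection x‖ ^ 2 := by
    have := he.tsum_inner_products_le (W.starProjection x)
    simpa only [hinner, norm_inner_symm _ x, hx.tsum_eq] using this
  rw [W.mem_iff_norm_starProjection]
  exact le_antisymm (W.norm_starProjection_apply_le x)
    (le_of_sq_le_sq hbessel (norm_nonneg _))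

theorem IsONB.isParsevalFrame {J : Type*} {e : J → E} (he : IsONB e) : IsParsevalFrame e := by
  obtain ⟨b, rfl⟩ := he
  intro v
  have h := (b.hasSum_inner_mul_inner v v).mapL Complex.reCLM
  convert h using 1
  · ext j
    rw [← inner_conj_symm (b j), Complex.reCLM_apply, Complex.mul_conj, Complex.ofReal_re,
      Complex.normSq_eq_norm_sq]
  · rw [Complex.reCLM_apply, inner_self_eq_norm_sq_to_K]
    norm_cast

theorem apply_eq_self_of_adjoint_apply_eq_self [CompleteSpace E] {T : E →L[ℂ] E} {x : E}
    (hT : ‖T x‖ ≤ ‖x‖) (hx : adjoint T x = x) : T x = x := by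
  have hsq : ‖T x - x‖ ^ 2 ≤ 0 := by
    rw [@norm_sub_sq ℂ, ← adjoint_inner_right, hx, inner_self_eq_norm_sq]
    have := pow_le_pow_left₀ (norm_nonneg _) hT 2
    linarith
  simpa [sub_eq_zero] using hsq.antisymm (by positivity)

end Hilbert

section WordOp

variable {N : ℕ} {E : Type*} [NormedAddCommGroup E] [InnerProductSpace ℂ E]
  (T : Fin N → E →L[ℂ] E)

@[simp] theorem wordOp_nil : wordOp T [] = 1 := rfl

theorem wordOp_cons (i : Fin N) (ω : List (Fin N)) : wordOp T (i :: ω) = T i * wordOp T ω := by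
  simp [wordOp]

theorem wordOp_append (ω τ : List (Fin N)) : wordOp T (ω ++ τ) = wordOp T ω * wordOp T τ := by
  simp [wordOp]

theorem adjoint_wordOp_nil [CompleteSpace E] : adjoint (wordOp T []) = 1 := by
  rw [wordOp_nil, ← star_eq_adjoint, star_one]

theorem adjoint_wordOp_cons [CompleteSpace E] (i : Fin N) (ω : List (Fin N)) :
    adjoint (wordOp T (i :: ω)) = adjoint (wordOp T ω) * adjoint (T i) := by
  simp only [wordOp_cons, ← star_eq_adjoint, star_mul]

variable {T} {β : List (Fin N)} {x : E}

theorem wordOp_append_wordPow_apply (hx : wordOp T β x = x) (ω : List (Fin N)) (k : ℕ) :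
    wordOp T (ω ++ wordPow β k) x = wordOp T ω x := by
  induction k with
  | zero => simp
  | succ k ih =>
    rw [wordPow_add, wordPow_one, ← List.append_assoc, wordOp_append, mul_apply_eq_comp, hx, ih]

theorem range_wordOp_wordsNotEndingIn (hβ : β ≠ []) (hx : wordOp T β x = x) :
    Set.range (fun ω : wordsNotEndingIn β => wordOp T ω.1 x) =
      Set.range fun ω => wordOp T ω x := by
  refine (Set.range_comp_subset_range Subtype.val fun ω => wordOp T ω x).antisymm ?_
  rintro _ ⟨ω, rfl⟩
  obtain ⟨τ, hτ, k, rfl⟩ := exists_eq_append_wordPow hβ ω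
  exact ⟨⟨τ, hτ⟩, (wordOp_append_wordPow_apply hx τ k).symm⟩

variable (T) in
/-- The closed linear span of the vectors `T_ω x` with `x ∈ s`. -/
def wordSpan (s : Set E) : Submodule ℂ E :=
  (Submodule.span ℂ (Set.image2 (fun ω x => wordOp T ω x) Set.univ s)).topologicalClosure

theorem isClosed_wordSpan (s : Set E) : IsClosed (wordSpan T s : Set E) :=
  Submodule.isClosed_topologicalClosure _

variable (T) in
theorem wordSpan_singleton (x : E) :
    wordSpan T {x} = (Submodule.span ℂ (Set.range fun ω => wordOp T ω x)).topologicalClosure := by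
  rw [wordSpan, Set.image2_singleton_right, Set.image_univ]

theorem wordSpan_singleton_eq_wordsNotEndingIn (hβ : β ≠ []) (hx : wordOp T β x = x) :
    wordSpan T {x} = (Submodule.span ℂ
      (Set.range fun ω : wordsNotEndingIn β => wordOp T ω.1 x)).topologicalClosure := by
  rw [wordSpan_singleton, range_wordOp_wordsNotEndingIn hβ hx]

theorem wordOp_apply_mem_wordSpan {s : Set E} (ω : List (Fin N)) (hx : x ∈ s) :
    wordOp T ω x ∈ wordSpan T s :=
  Submodule.le_topologicalClosure _ (Submodule.subset_span ⟨ω, Set.mem_univ ω, x, hx, rfl⟩)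

theorem subset_wordSpan (s : Set E) : s ⊆ wordSpan T s :=
  fun _ hx => wordOp_apply_mem_wordSpan [] hx

theorem wordSpan_le {s : Set E} {W : Submodule ℂ E} (hW : IsClosed (W : Set E))
    (h : ∀ ω, ∀ x ∈ s, wordOp T ω x ∈ W) : wordSpan T s ≤ W := by
  refine Submodule.topologicalClosure_minimal _ (Submodule.span_le.mpr ?_) hW
  rintro _ ⟨ω, -, x, hx, rfl⟩
  exact h ω x hx

theorem ext_of_wordSpan_eq_top {F : Type*} [NormedAddCommGroup F] [NormedSpace ℂ F]
    {s : Set E} (hs : wordSpan T s = ⊤) {A B : E →L[ℂ] F}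
    (h : ∀ ω, ∀ x ∈ s, A (wordOp T ω x) = B (wordOp T ω x)) : A = B := by
  refine ContinuousLinearMap.ext_on (Submodule.dense_iff_topologicalClosure_eq_top.mpr hs) ?_
  rintro _ ⟨ω, -, x, hx, rfl⟩
  exact h ω x hx

end WordOp

section Reducing

variable {I E : Type*} [NormedAddCommGroup E] [InnerProductSpace ℂ E] [CompleteSpace E]

/-- `W` is reducing for the family `S`: it is invariant under all `S_i` and `S_i^*`. Closedness is
not part of the definition. -/
structure IsReducing (S : I → E →L[ℂ] E) (W : Submodule ℂ E) : Prop where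
  apply_mem : ∀ i, ∀ x ∈ W, S i x ∈ W
  adjoint_apply_mem : ∀ i, ∀ x ∈ W, adjoint (S i) x ∈ W

namespace IsReducing

variable {S : I → E →L[ℂ] E} {W : Submodule ℂ E} [W.HasOrthogonalProjection]

theorem commute_starProjection (hW : IsReducing S W) (i : I) : Commute W.starProjection (S i) := by
  rw [IsIdempotentElem.commute_iff W.isIdempotentElem_starProjection,
    Submodule.range_starProjection, Submodule.ker_starProjection, ← mem_invtSubmodule_adjoint_iff]
  exact ⟨hW.apply_mem i, hW.adjoint_apply_mem i⟩

theorem apply_mem_of_mem_adjoin (hW : IsReducing S W) {A : E →L[ℂ] E}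
    (hA : A ∈ StarAlgebra.adjoin ℂ (Set.range S)) {x : E} (hx : x ∈ W) : A x ∈ W := by
  have hle : StarAlgebra.adjoin ℂ (Set.range S) ≤
      StarSubalgebra.centralizer ℂ {W.starProjection} := by
    refine StarAlgebra.adjoin_le ?_
    rintro _ ⟨i, rfl⟩
    rw [SetLike.mem_coe, StarSubalgebra.mem_centralizer_iff]
    rintro _ rfl
    rw [(isSelfAdjoint_starProjection W).star_eq]
    exact ⟨hW.commute_starProjection i, hW.commute_starProjection i⟩
  have hcomm : W.starProjection * A = A * W.starProjection :=
    ((StarSubalgebra.mem_centralizer_iff ℂ).mp (hle hA) _ rfl).1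
  rw [← Submodule.starProjection_eq_self_iff] at hx ⊢
  rw [← mul_apply_eq_comp, hcomm, mul_apply_eq_comp, hx]

theorem eq_bot_or_eq_top (hW : IsReducing S W)
    (h : Set.centralizer (Set.range S) ⊆ scalarOps E) : W = ⊥ ∨ W = ⊤ := by
  obtain ⟨c, hc⟩ : W.starProjection ∈ scalarOps E := h <| by
    rintro _ ⟨i, rfl⟩
    exact (hW.commute_starProjection i).symm.eq
  have hP (x : E) : W.starProjection x = c • x := (DFunLike.congr_fun hc x).symm
  rcases eq_or_ne c 0 with rfl | hc₀
  · refine .inl (W.eq_bot_iff.mpr fun x hx => ?_)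
    rw [← Submodule.starProjection_eq_self_iff.mpr hx, hP, zero_smul]
  · refine .inr (W.eq_top_iff'.mpr fun x => ?_)
    rw [← W.smul_mem_iff hc₀, ← hP]
    exact W.starProjection_apply_mem x

end IsReducing

end Reducing

section SigmaMap

variable {N : ℕ} {E : Type*} [NormedAddCommGroup E] [InnerProductSpace ℂ E] [CompleteSpace E]
  {T : Fin N → E →L[ℂ] E}

variable (T) in
/-- The map `σ_T : X ↦ ∑ T_i X T_i^*` on bounded operators. -/
noncomputable def sigmaMap : (E →L[ℂ] E) →ₗ[ℂ] (E →L[ℂ] E) :=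
  ∑ i, LinearMap.mulLeftRight ℂ (T i, adjoint (T i))

theorem sigmaMap_apply (X : E →L[ℂ] E) : sigmaMap T X = ∑ i, T i * X * adjoint (T i) := by
  simp [sigmaMap]

theorem mem_sigmaFixedPoints {X : E →L[ℂ] E} :
    X ∈ sigmaFixedPoints T ↔ sigmaMap T X = X := by
  rw [sigmaMap_apply]
  rfl

theorem inner_sigmaMap (X : E →L[ℂ] E) (x y : E) :
    inner ℂ (sigmaMap T X x) y = ∑ i, inner ℂ (X (adjoint (T i) x)) (adjoint (T i) y) := by
  simp [sigmaMap_apply, sum_apply, adjoint_inner_right]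

namespace IsRowCoisometry

theorem sigmaMap_one (hT : IsRowCoisometry T) : sigmaMap T 1 = 1 := by
  simp only [sigmaMap_apply, mul_one]
  exact hT

theorem scalarOps_subset_sigmaFixedPoints (hT : IsRowCoisometry T) :
    scalarOps E ⊆ sigmaFixedPoints T := by
  rintro _ ⟨c, rfl⟩
  rw [mem_sigmaFixedPoints, map_smul, hT.sigmaMap_one]

theorem sum_norm_adjoint_sq (hT : IsRowCoisometry T) (x : E) :
    ∑ i, ‖adjoint (T i) x‖ ^ 2 = ‖x‖ ^ 2 := by
  have h := inner_sigmaMap (T := T) 1 x x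
  simp only [hT.sigmaMap_one, one_apply_eq_self, inner_self_eq_norm_sq_to_K] at h
  exact_mod_cast h.symm

theorem norm_sigmaMap_le (hT : IsRowCoisometry T) (X : E →L[ℂ] E) : ‖sigmaMap T X‖ ≤ ‖X‖ := by
  refine opNorm_le_of_re_inner_le (norm_nonneg _) fun x y hx hy => ?_
  calc RCLike.re (inner ℂ (sigmaMap T X x) y)
      ≤ ‖inner ℂ (sigmaMap T X x) y‖ := RCLike.re_le_norm _
    _ ≤ ∑ i, ‖X‖ * ‖adjoint (T i) x‖ * ‖adjoint (T i) y‖ := by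
      rw [inner_sigmaMap]
      refine norm_sum_le_of_le _ fun i _ => (norm_inner_le_norm _ _).trans ?_
      gcongr
      exact X.le_opNorm _
    _ = ‖X‖ * ∑ i, ‖adjoint (T i) x‖ * ‖adjoint (T i) y‖ := by
      simp only [Finset.mul_sum, mul_assoc]
    _ ≤ ‖X‖ * (√(∑ i, ‖adjoint (T i) x‖ ^ 2) * √(∑ i, ‖adjoint (T i) y‖ ^ 2)) := by
      gcongr
      exact Real.sum_mul_le_sqrt_mul_sqrt _ _ _
    _ = ‖X‖ := by simp [hT.sum_norm_adjoint_sq, hx, hy]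

theorem norm_iterate_sigmaMap_le (hT : IsRowCoisometry T) (X : E →L[ℂ] E) (n : ℕ) :
    ‖(sigmaMap T)^[n] X‖ ≤ ‖X‖ := by
  induction n with
  | zero => rfl
  | succ n ih =>
    rw [Function.iterate_succ_apply']
    exact (hT.norm_sigmaMap_le _).trans ih

end IsRowCoisometry

end SigmaMap

section Cuntz

variable {N : ℕ} {H : Type*} [NormedAddCommGroup H] [InnerProductSpace ℂ H] [CompleteSpace H]
  {S : Fin N → H →L[ℂ] H}

namespace IsCuntzFamily

theorem isRowCoisometry (hS : IsCuntzFamily S) : IsRowCoisometry S :=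
  hS.sum_mul_adjoint

theorem adjoint_wordOp_mul_self (hS : IsCuntzFamily S) (ω : List (Fin N)) :
    adjoint (wordOp S ω) * wordOp S ω = 1 := by
  induction ω with
  | nil => rw [adjoint_wordOp_nil, wordOp_nil, one_mul]
  | cons i ω ih =>
    rw [adjoint_wordOp_cons, wordOp_cons, mul_assoc, ← mul_assoc _ (S i), hS.adjoint_mul,
      if_pos rfl, one_mul, ih]

theorem norm_wordOp_apply (hS : IsCuntzFamily S) (ω : List (Fin N)) (x : H) :
    ‖wordOp S ω x‖ = ‖x‖ :=
  (norm_map_iff_adjoint_comp_self _).mpr (hS.adjoint_wordOp_mul_self ω) x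

theorem adjoint_wordOp_mul_eq_zero (hS : IsCuntzFamily S) {a b : List (Fin N)}
    (hab : ¬ a <+: b) (hba : ¬ b <+: a) : adjoint (wordOp S a) * wordOp S b = 0 := by
  induction a generalizing b with
  | nil => exact absurd List.nil_prefix hab
  | cons i a ih =>
    cases b with
    | nil => exact absurd List.nil_prefix hba
    | cons j b =>
      rw [adjoint_wordOp_cons, wordOp_cons, mul_assoc, ← mul_assoc _ (S j), hS.adjoint_mul]
      split_ifs with hij
      · subst hij
        rw [List.cons_prefix_cons, and_iff_right rfl] at hab hba
        rw [one_mul, ih hab hba]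
      · rw [zero_mul, mul_zero]

theorem inner_wordOp_eq_zero (hS : IsCuntzFamily S) {a b : List (Fin N)}
    (hab : ¬ a <+: b) (hba : ¬ b <+: a) (x y : H) :
    inner ℂ (wordOp S a x) (wordOp S b y) = 0 := by
  rw [← adjoint_inner_right, ← mul_apply_eq_comp, hS.adjoint_wordOp_mul_eq_zero hab hba, zero_apply,
    inner_zero_right]

theorem sigmaMap_mul (hS : IsCuntzFamily S) (X : H →L[ℂ] H) (i : Fin N) :
    sigmaMap S X * S i = S i * X := by
  simp [sigmaMap_apply, Finset.sum_mul, mul_assoc, hS.adjoint_mul]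

theorem adjoint_mul_sigmaMap (hS : IsCuntzFamily S) (X : H →L[ℂ] H) (i : Fin N) :
    adjoint (S i) * sigmaMap S X = X * adjoint (S i) := by
  simp [sigmaMap_apply, Finset.mul_sum, ← mul_assoc, hS.adjoint_mul]

theorem iterate_sigmaMap_mul_wordOp (hS : IsCuntzFamily S) (X : H →L[ℂ] H) (n : ℕ)
    (ω : List (Fin N)) :
    (sigmaMap S)^[n + ω.length] X * wordOp S ω = wordOp S ω * (sigmaMap S)^[n] X := by
  induction ω with
  | nil => simp
  | cons i ω ih =>
    rw [List.length_cons, ← add_assoc, Function.iterate_succ_apply', wordOp_cons, ← mul_assoc,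
      hS.sigmaMap_mul, mul_assoc, ih, mul_assoc]

theorem sigmaFixedPoints_eq_centralizer (hS : IsCuntzFamily S) :
    sigmaFixedPoints S = Set.centralizer (Set.range S) := by
  ext A
  rw [mem_sigmaFixedPoints]
  constructor
  · rintro hA _ ⟨i, rfl⟩
    rw [← hS.sigmaMap_mul A i, hA]
  · intro hA
    have hcomm (i : Fin N) : S i * A = A * S i := hA _ ⟨i, rfl⟩
    simp only [sigmaMap_apply, hcomm, mul_assoc, ← Finset.mul_sum,
      hS.sum_mul_adjoint, mul_one]

theorem commute_wordOp (hS : IsCuntzFamily S) {A : H →L[ℂ] H} (hA : A ∈ sigmaFixedPoints S)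
    (ω : List (Fin N)) : Commute A (wordOp S ω) := by
  rw [hS.sigmaFixedPoints_eq_centralizer] at hA
  refine Commute.list_prod_right _ _ fun _ hT => ?_
  obtain ⟨i, -, rfl⟩ := List.mem_map.mp hT
  exact (hA _ ⟨i, rfl⟩).symm

theorem commute_adjoint_wordOp (hS : IsCuntzFamily S) {A : H →L[ℂ] H}
    (hA : A ∈ sigmaFixedPoints S) (ω : List (Fin N)) : Commute A (adjoint (wordOp S ω)) := by
  have hadj (i : Fin N) : Commute A (adjoint (S i)) := by
    have h := hS.adjoint_mul_sigmaMap A i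
    rw [mem_sigmaFixedPoints.mp hA] at h
    exact h.symm
  induction ω with
  | nil => rw [adjoint_wordOp_nil]; exact Commute.one_right A
  | cons i ω ih => rw [adjoint_wordOp_cons]; exact ih.mul_right (hadj i)

theorem adjoint_apply_wordOp_cons_mem_wordSpan (hS : IsCuntzFamily S) {s : Set H} {x : H}
    (hx : x ∈ s) (i j : Fin N) (ω : List (Fin N)) :
    adjoint (S i) (wordOp S (j :: ω) x) ∈ wordSpan S s := by
  rw [wordOp_cons, ← mul_apply_eq_comp, ← mul_assoc, hS.adjoint_mul]
  split_ifs
  · rw [one_mul]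
    exact wordOp_apply_mem_wordSpan ω hx
  · simp

theorem isReducing_wordSpan (hS : IsCuntzFamily S) {s : Set H}
    (hs : ∀ i, ∀ x ∈ s, adjoint (S i) x ∈ wordSpan S s) : IsReducing S (wordSpan S s) where
  apply_mem i := by
    refine wordSpan_le (W := (wordSpan S s).comap (S i).toLinearMap)
      ((isClosed_wordSpan s).preimage (S i).continuous) fun ω x hx => ?_
    simpa [wordOp_cons] using wordOp_apply_mem_wordSpan (i :: ω) hx
  adjoint_apply_mem i := by
    refine wordSpan_le (W := (wordSpan S s).comap (adjoint (S i)).toLinearMap)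
      ((isClosed_wordSpan s).preimage (adjoint (S i)).continuous) fun ω x hx => ?_
    cases ω with
    | nil => exact hs i x hx
    | cons j ω => exact hS.adjoint_apply_wordOp_cons_mem_wordSpan hx i j ω

variable {β : List (Fin N)} {x : H}

theorem isReducing_wordSpan_singleton (hS : IsCuntzFamily S) (hβ : β ≠ [])
    (hx : wordOp S β x = x) : IsReducing S (wordSpan S {x}) := by
  obtain ⟨j, β', rfl⟩ := List.exists_cons_of_ne_nil hβ
  refine hS.isReducing_wordSpan fun i => ?_
  have h := hS.adjoint_apply_wordOp_cons_mem_wordSpan (Set.mem_singleton x) i j β'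
  rw [hx] at h
  simpa only [Set.mem_singleton_iff, forall_eq] using h

theorem eventually_inner_iterate_sigmaMap_eq_zero (hS : IsCuntzFamily S)
    (hβ : IsIrreducibleWord β) (hx : wordOp S β x = x) (X : H →L[ℂ] H) {γ δ : List (Fin N)}
    (hγ : γ ∈ wordsNotEndingIn β) (hδ : δ ∈ wordsNotEndingIn β) (hne : γ ≠ δ) :
    ∀ᶠ n in atTop, inner ℂ ((sigmaMap S)^[n] X (wordOp S γ x)) (wordOp S δ x) = 0 := by
  obtain ⟨k, m, hab, hba⟩ := hβ.exists_incomparable hγ hδ hne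
  filter_upwards [eventually_ge_atTop (γ ++ wordPow β k).length] with n hn
  obtain ⟨l, rfl⟩ := Nat.exists_eq_add_of_le' hn
  rw [← wordOp_append_wordPow_apply hx γ k, ← wordOp_append_wordPow_apply hx δ m,
    ← mul_apply_eq_comp, hS.iterate_sigmaMap_mul_wordOp, mul_apply_eq_comp,
    hS.inner_wordOp_eq_zero hab hba]

theorem orthonormal_wordOp (hS : IsCuntzFamily S) (hβ : IsIrreducibleWord β)
    (hx : wordOp S β x = x) (hnorm : ‖x‖ = 1) :
    Orthonormal ℂ fun ω : wordsNotEndingIn β => wordOp S ω.1 x := by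
  refine ⟨fun ω => by rw [hS.norm_wordOp_apply, hnorm], fun γ δ hne => ?_⟩
  obtain ⟨k, m, hab, hba⟩ := hβ.exists_incomparable γ.2 δ.2 (Subtype.coe_injective.ne hne)
  beta_reduce
  rw [← wordOp_append_wordPow_apply hx γ k, ← wordOp_append_wordPow_apply hx δ m,
    hS.inner_wordOp_eq_zero hab hba]

theorem isONB_wordOp (hS : IsCuntzFamily S) (hβ : IsIrreducibleWord β)
    (hx : wordOp S β x = x) (hnorm : ‖x‖ = 1) (hcyc : wordSpan S {x} = ⊤) :
    IsONB fun ω : wordsNotEndingIn β => wordOp S ω.1 x := by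
  rw [wordSpan_singleton_eq_wordsNotEndingIn hβ.1 hx] at hcyc
  exact ⟨HilbertBasis.mk (hS.orthonormal_wordOp hβ hx hnorm) hcyc.ge, HilbertBasis.coe_mk _ _⟩

theorem tendsto_inner_iterate_sigmaMap_zero (hS : IsCuntzFamily S) (hβ : IsIrreducibleWord β)
    (hx : wordOp S β x = x) (hcyc : wordSpan S {x} = ⊤) {X : H →L[ℂ] H}
    (hX : ∀ n, inner ℂ ((sigmaMap S)^[n] X x) x = 0) (y z : H) :
    Tendsto (fun n => inner ℂ ((sigmaMap S)^[n] X y) z) atTop (𝓝 0) := by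
  rw [wordSpan_singleton_eq_wordsNotEndingIn hβ.1 hx] at hcyc
  refine tendsto_inner_zero_of_dense_span (Submodule.dense_iff_topologicalClosure_eq_top.mpr hcyc)
    (hS.isRowCoisometry.norm_iterate_sigmaMap_le X) ?_ y z
  rintro _ ⟨γ, rfl⟩ _ ⟨δ, rfl⟩
  apply tendsto_const_nhds.congr'
  rcases eq_or_ne γ δ with rfl | hne
  · filter_upwards [eventually_ge_atTop γ.1.length] with n hn
    obtain ⟨l, rfl⟩ := Nat.exists_eq_add_of_le' hn
    rw [← mul_apply_eq_comp, hS.iterate_sigmaMap_mul_wordOp, mul_apply_eq_comp,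
      ← adjoint_inner_left, ← mul_apply_eq_comp, hS.adjoint_wordOp_mul_self, one_apply_eq_self, hX]
  · filter_upwards [hS.eventually_inner_iterate_sigmaMap_eq_zero hβ hx X γ.2 δ.2
      (Subtype.coe_injective.ne hne)] with n hn
    exact hn.symm

end IsCuntzFamily

end Cuntz

section Compression

variable {K H : Type*}
  [NormedAddCommGroup K] [InnerProductSpace ℂ K] [CompleteSpace K]
  [NormedAddCommGroup H] [InnerProductSpace ℂ H] [CompleteSpace H]

/-- The compression `p X|_K` of a bounded operator `X` on `H` to the subspace `K`, which is embedded
in `H` by `ι`. -/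
noncomputable def compression (ι : K →ₗᵢ[ℂ] H) (X : H →L[ℂ] H) : K →L[ℂ] K :=
  adjoint ι.toContinuousLinearMap ∘L X ∘L ι.toContinuousLinearMap

variable (ι : K →ₗᵢ[ℂ] H)

theorem inner_compression (X : H →L[ℂ] H) (k k' : K) :
    inner ℂ (compression ι X k) k' = inner ℂ (X (ι k)) (ι k') := by
  simp [compression, adjoint_inner_left]

theorem compression_smul_one (c : ℂ) : compression ι (c • 1) = c • 1 := by
  ext k
  refine ext_inner_right ℂ fun k' => ?_
  simp [inner_compression, ← map_smul]

theorem compression_surjective : Function.Surjective (compression ι) := by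
  intro B
  have hι (k : K) : adjoint ι.toContinuousLinearMap (ι k) = k :=
    DFunLike.congr_fun ((norm_map_iff_adjoint_comp_self _).mp ι.norm_map) k
  refine ⟨ι.toContinuousLinearMap ∘L B ∘L adjoint ι.toContinuousLinearMap, ?_⟩
  ext k
  simp only [compression, comp_apply, LinearIsometry.coe_toContinuousLinearMap, hι]

end Compression

section Dilation

variable {N : ℕ} {K H : Type*}
  [NormedAddCommGroup K] [InnerProductSpace ℂ K] [CompleteSpace K]
  [NormedAddCommGroup H] [InnerProductSpace ℂ H] [CompleteSpace H]
  {V : Fin N → K →L[ℂ] K} {S : Fin N → H →L[ℂ] H} {ι : K →ₗᵢ[ℂ] H}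

namespace IsCuntzDilation

theorem adjoint_wordOp_apply (hS : IsCuntzDilation V S ι) (ω : List (Fin N)) (k : K) :
    adjoint (wordOp S ω) (ι k) = ι (adjoint (wordOp V ω) k) := by
  induction ω generalizing k with
  | nil => simp only [adjoint_wordOp_nil, one_apply_eq_self]
  | cons i ω ih => simp only [adjoint_wordOp_cons, mul_apply_eq_comp, hS.adjoint_apply, ih]

theorem inner_wordOp (hS : IsCuntzDilation V S ι) (ω : List (Fin N)) (v k : K) :
    inner ℂ (ι v) (wordOp S ω (ι k)) = inner ℂ v (wordOp V ω k) := by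
  rw [← adjoint_inner_left, hS.adjoint_wordOp_apply, ι.inner_map_map, adjoint_inner_left]

theorem isParsevalFrame_iff (hS : IsCuntzDilation V S ι) {J : Type*} {word : J → List (Fin N)}
    {k : K} :
    IsParsevalFrame (fun j => wordOp V (word j) k) ↔
      ∀ v, HasSum (fun j => ‖inner ℂ (ι v) (wordOp S (word j) (ι k))‖ ^ 2) (‖ι v‖ ^ 2) := by
  simp only [IsParsevalFrame, hS.inner_wordOp, ι.norm_map]

theorem eq_top_of_isReducing (hS : IsCuntzDilation V S ι) {W : Submodule ℂ H}
    (hclosed : IsClosed (W : Set H)) (hW : IsReducing S W) (hK : ∀ k, ι k ∈ W) : W = ⊤ := by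
  have := hclosed.completeSpace_coe
  rw [eq_top_iff, ← hS.cyclic]
  refine Submodule.topologicalClosure_minimal _ (Submodule.span_le.mpr ?_) hclosed
  rintro _ ⟨A, hA, k, rfl⟩
  exact hW.apply_mem_of_mem_adjoin hA (hK k)

theorem wordSpan_range_eq_top (hS : IsCuntzDilation V S ι) : wordSpan S (Set.range ι) = ⊤ := by
  have hmem (k : K) : ι k ∈ wordSpan S (Set.range ι) := subset_wordSpan _ ⟨k, rfl⟩
  refine hS.eq_top_of_isReducing (isClosed_wordSpan _) (hS.cuntz.isReducing_wordSpan ?_) hmem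
  rintro i _ ⟨k, rfl⟩
  rw [hS.adjoint_apply]
  exact hmem _

theorem semiconj_compression (hS : IsCuntzDilation V S ι) :
    Function.Semiconj (compression ι) (sigmaMap S) (sigmaMap V) := by
  intro X
  ext k
  refine ext_inner_right ℂ fun k' => ?_
  simp only [inner_compression, inner_sigmaMap, hS.adjoint_apply]

theorem injOn_compression (hS : IsCuntzDilation V S ι) :
    Set.InjOn (compression ι) (sigmaFixedPoints S) := by
  intro A hA B hB hAB
  have hcoeff {C : H →L[ℂ] H} (hC : C ∈ sigmaFixedPoints S) (k k' : K) (ω : List (Fin N)) :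
      inner ℂ (C (ι k)) (wordOp S ω (ι k')) =
        inner ℂ (compression ι C (adjoint (wordOp V ω) k)) k' := by
    rw [← adjoint_inner_left, ← mul_apply_eq_comp, ← (hS.cuntz.commute_adjoint_wordOp hC ω).eq,
      mul_apply_eq_comp, hS.adjoint_wordOp_apply, inner_compression]
  have hK (k : K) : A (ι k) = B (ι k) := by
    have h : innerSL ℂ (A (ι k)) = innerSL ℂ (B (ι k)) := by
      refine ext_of_wordSpan_eq_top hS.wordSpan_range_eq_top ?_
      rintro ω _ ⟨k', rfl⟩
      simp only [innerSL_apply_apply, hcoeff hA, hcoeff hB, hAB]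
    exact ext_inner_right ℂ (DFunLike.congr_fun h)
  refine ext_of_wordSpan_eq_top hS.wordSpan_range_eq_top ?_
  rintro ω _ ⟨k, rfl⟩
  rw [← mul_apply_eq_comp, ← mul_apply_eq_comp, (hS.cuntz.commute_wordOp hA ω).eq,
    (hS.cuntz.commute_wordOp hB ω).eq, mul_apply_eq_comp, mul_apply_eq_comp, hK]

theorem centralizer_eq_scalarOps (hS : IsCuntzDilation V S ι)
    (h : sigmaFixedPoints V ⊆ scalarOps K) : Set.centralizer (Set.range S) = scalarOps H := by
  rw [← hS.cuntz.sigmaFixedPoints_eq_centralizer]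
  have hscalar := hS.cuntz.isRowCoisometry.scalarOps_subset_sigmaFixedPoints
  refine Set.Subset.antisymm (fun A hA => ?_) hscalar
  obtain ⟨c, hc⟩ : compression ι A ∈ scalarOps K :=
    h <| by rw [mem_sigmaFixedPoints, ← hS.semiconj_compression, mem_sigmaFixedPoints.mp hA]
  exact ⟨c, hS.injOn_compression (hscalar ⟨c, rfl⟩) hA ((compression_smul_one ι c).trans hc)⟩

theorem exists_forall_compression_iterate_sigmaMap_eq (hS : IsCuntzDilation V S ι)
    {B : K →L[ℂ] K} (hB : B ∈ sigmaFixedPoints V) :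
    ∃ X, ∀ n, compression ι ((sigmaMap S)^[n] X) = B := by
  obtain ⟨X, rfl⟩ := compression_surjective ι B
  refine ⟨X, fun n => ?_⟩
  rw [hS.semiconj_compression.iterate_right n X,
    Function.iterate_fixed (mem_sigmaFixedPoints.mp hB)]

variable {v₀ : K} {β : List (Fin N)}

theorem eq_zero_of_mem_sigmaFixedPoints (hS : IsCuntzDilation V S ι) (hβ : IsIrreducibleWord β)
    (hfix : wordOp S β (ι v₀) = ι v₀) (hcyc : wordSpan S {ι v₀} = ⊤) {B : K →L[ℂ] K}
    (hB : B ∈ sigmaFixedPoints V) (hB₀ : inner ℂ (B v₀) v₀ = 0) : B = 0 := by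
  obtain ⟨X, hX⟩ := hS.exists_forall_compression_iterate_sigmaMap_eq hB
  have hcoeff (n : ℕ) (k k' : K) :
      inner ℂ ((sigmaMap S)^[n] X (ι k)) (ι k') = inner ℂ (B k) k' := by
    rw [← inner_compression, hX]
  ext k
  refine ext_inner_right ℂ fun k' => ?_
  have hlim := hS.cuntz.tendsto_inner_iterate_sigmaMap_zero hβ hfix hcyc
    (fun n => (hcoeff n v₀ v₀).trans hB₀) (ι k) (ι k')
  simp only [hcoeff] at hlim
  simpa using tendsto_nhds_unique tendsto_const_nhds hlim

theorem sigmaFixedPoints_subset_scalarOps (hS : IsCuntzDilation V S ι) (hV : IsRowCoisometry V)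
    (hv₀ : ‖v₀‖ = 1) (hβ : IsIrreducibleWord β) (hfix : wordOp S β (ι v₀) = ι v₀)
    (hcyc : wordSpan S {ι v₀} = ⊤) : sigmaFixedPoints V ⊆ scalarOps K := by
  intro A hA
  set c : ℂ := inner ℂ v₀ (A v₀) with hc
  have hB : A - c • 1 ∈ sigmaFixedPoints V := by
    rw [mem_sigmaFixedPoints, map_sub, map_smul, hV.sigmaMap_one, mem_sigmaFixedPoints.mp hA]
  have hB₀ : inner ℂ ((A - c • 1) v₀) v₀ = 0 := by
    rw [← inner_conj_symm, map_eq_zero]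
    simp [inner_sub_right, inner_smul_right, ← hc, inner_self_eq_norm_sq_to_K, hv₀]
  exact ⟨c, (sub_eq_zero.mp (hS.eq_zero_of_mem_sigmaFixedPoints hβ hfix hcyc hB hB₀)).symm⟩

theorem wordSpan_eq_top_of_isParsevalFrame (hS : IsCuntzDilation V S ι) (hv₀ : ‖v₀‖ = 1)
    (hβ : IsIrreducibleWord β) (hfix : wordOp S β (ι v₀) = ι v₀)
    (h : IsParsevalFrame fun ω : wordsNotEndingIn β => wordOp V ω.1 v₀) :
    wordSpan S {ι v₀} = ⊤ := by
  have horth := hS.cuntz.orthonormal_wordOp hβ hfix (by rwa [ι.norm_map])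
  refine hS.eq_top_of_isReducing (isClosed_wordSpan _)
    (hS.cuntz.isReducing_wordSpan_singleton hβ.1 hfix) fun k => ?_
  rw [wordSpan_singleton_eq_wordsNotEndingIn hβ.1 hfix]
  exact mem_topologicalClosure_span_of_hasSum_sq_norm_inner horth (hS.isParsevalFrame_iff.mp h k)

theorem wordOp_apply_eq_self (hS : IsCuntzDilation V S ι)
    (hfix : adjoint (wordOp V β) v₀ = v₀) : wordOp S β (ι v₀) = ι v₀ :=
  apply_eq_self_of_adjoint_apply_eq_self (hS.cuntz.norm_wordOp_apply β _).le
    (by rw [hS.adjoint_wordOp_apply, hfix])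

end IsCuntzDilation

end Dilation

theorem theorem3p9 {N : ℕ} (hN : 2 ≤ N) {K H : Type*}
    [NormedAddCommGroup K] [InnerProductSpace ℂ K] [CompleteSpace K]
    [NormedAddCommGroup H] [InnerProductSpace ℂ H] [CompleteSpace H]
    (V : Fin N → K →L[ℂ] K) (hV : IsRowCoisometry V)
    (S : Fin N → H →L[ℂ] H) (ι : K →ₗᵢ[ℂ] H) (hS : IsCuntzDilation V S ι)
    (v₀ : K) (hv₀ : ‖v₀‖ = 1)
    (β : List (Fin N)) (hβ : IsIrreducibleWord β)
    (hfix : ContinuousLinearMap.adjoint (wordOp V β) v₀ = v₀) :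
    List.TFAE [
      IsParsevalFrame (fun ω : wordsNotEndingIn β => wordOp V ω.1 v₀),
      IsONB (fun ω : wordsNotEndingIn β => wordOp S ω.1 (ι v₀)),
      (Submodule.span ℂ
        (Set.range fun ω : List (Fin N) => wordOp S ω (ι v₀))).topologicalClosure = ⊤,
      IsIrreducibleRep S,
      Set.centralizer (Set.range S) = scalarOps H,
      sigmaFixedPoints V = scalarOps K] := by
  have hfixS : wordOp S β (ι v₀) = ι v₀ := hS.wordOp_apply_eq_self hfix
  have hnorm : ‖ι v₀‖ = 1 := by rw [ι.norm_map, hv₀]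
  have hne : ι v₀ ≠ 0 := ne_zero_of_norm_ne_zero (by rw [hnorm]; exact one_ne_zero)
  have hred : IsReducing S (wordSpan S {ι v₀}) :=
    hS.cuntz.isReducing_wordSpan_singleton hβ.1 hfixS
  rw [← wordSpan_singleton S (ι v₀)]
  tfae_have 1 → 3 := hS.wordSpan_eq_top_of_isParsevalFrame hv₀ hβ hfixS
  tfae_have 3 → 2 := hS.cuntz.isONB_wordOp hβ hfixS hnorm
  tfae_have 2 → 1 := fun h => hS.isParsevalFrame_iff.mpr fun v => h.isParsevalFrame (ι v)
  tfae_have 3 → 6 := fun h => (hS.sigmaFixedPoints_subset_scalarOps hV hv₀ hβ hfixS h).antisymm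
    hV.scalarOps_subset_sigmaFixedPoints
  tfae_have 6 → 5 := fun h => hS.centralizer_eq_scalarOps h.subset
  tfae_have 5 → 4 := fun h => ⟨⟨ι v₀, 0, hne⟩, fun W hclosed hW hW' =>
    have := hclosed.completeSpace_coe
    IsReducing.eq_bot_or_eq_top ⟨hW, hW'⟩ h.subset⟩
  tfae_have 4 → 3 := fun h =>
    (h.2 _ (isClosed_wordSpan _) hred.apply_mem hred.adjoint_apply_mem).resolve_left
      ((Submodule.ne_bot_iff _).mpr ⟨ι v₀, subset_wordSpan _ rfl, hne⟩)
  tfae_finish
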